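/- There is a constant $c$ with $0\le c\le 4$ such that the following holds. Let $n\ge 0$ and let $\mathcal G$ be a set of elementary gates, regarded as unitary operators on $n$ qubits (a few-qubit operation being counted once for each choice of the qubits on which it may act). Assume that $\mathcal G$ is closed under inversion and universal, i.e. for every $n$-qubit unitary $U$ and every $\delta>0$ there are a finite product $V$ of elements of $\mathcal G$ and $z\in\mathbb C$ with $|z|=1$ and $\Vert V-zU\Vert\le\delta$ (operator norm). Then there is a constant $C>0$, depending only on $n$ and $\mathcal G$, such that for every Hamiltonian (Hermitian operator) $H$ on $n$ qubits and every normalized ground state $|\psi_0\rangle$ of $H$ (unit eigenvector for the lowest eigenvalue): there is a unitary $U$ with $U|0\rangle^{\otimes n}=|\psi_0\rangle$, and for every such $U$ and every $0<\varepsilon\le 1/2$ there is a quantum circuit $\tilde U=g_1\cdots g_l$ with $g_1,\dots,g_l\in\mathcal G$ such that 1. the number of gates satisfies $l\le C\log^c(1/\varepsilon)$; 2. $\tilde U$ is an $\varepsilon$-approximation of $U$ up to a global phase: $\Vert\tilde U-zU\Vert\le\varepsilon$ for some $z\in\mathbb C$ with $|z|=1$; 3. the state $|\tilde\psi_0\rangle=\tilde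 U|0\rangle^{\otimes n}$ satisfies $|\tilde S_0-S_0|\le C\varepsilon$ for every bipartition of the qubits into a set $A$ and its complement $B$ (in particular into two halves), where $S_0=-\operatorname{Tr}\rho_0^A\log_2\rho_0^A$ with $\rho_0^A=\operatorname{Tr}_B|\psi_0\rangle\langle\psi_0|$ is the von Neumann entropy of $A$ in $|\psi_0\rangle$, and $\tilde S_0$ is the same quantity for $|\tilde\psi_0\rangle$. -/

import Mathlib

open scoped Matrix.Norms.L2Operator

/-- Labels of the computational basis of `n` qubits, namely bit strings of length `n`. -/
abbrev BitString (n : ℕ) : Type := Fin n → Fin 2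

/-- State vectors of `n` qubits, as amplitudes in the computational basis. -/
abbrev QState (n : ℕ) : Type := BitString n → ℂ

/-- Operators on `n` qubits, as matrices in the computational basis. Their norm `‖M‖` is the
operator norm for the Hilbert space norm on state vectors. -/
abbrev QOperator (n : ℕ) : Type := Matrix (BitString n) (BitString n) ℂ

/-- Unitary operators on `n` qubits. -/
abbrev QUnitary (n : ℕ) : Type := Matrix.unitaryGroup (BitString n) ℂ

/-- The initial product state `|0⟩^{⊗ n}`. -/
def zeroState (n : ℕ) : QState n := Pi.single (fun _ => 0) 1

/-- `IsCircuit G L`: the list `L = [g₁, …, g_l]` is a circuit all of whose gates belong to `G`.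
It implements the product `L.prod = g₁ ⋯ g_l`, and its number of gates is `L.length`. An element
of `G` is an elementary gate regarded as an operator on all `n` qubits, so a one- or two-qubit
operation contributes one element to `G` for each choice of the qubits it may act on. -/
def IsCircuit {n : ℕ} (G : Set (QUnitary n)) (L : List (QUnitary n)) : Prop :=
  ∀ g ∈ L, g ∈ G

/-- `V` approximates `U` with precision `ε` in operator norm, up to a (physically irrelevant)
global phase. -/
def ApproxUpToPhase {n : ℕ} (V U : QUnitary n) (ε : ℝ) : Prop :=
  ∃ z : ℂ, ‖z‖ = 1 ∧ ‖(V : QOperator n) - z • (U : QOperator n)‖ ≤ ε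

/-- A gate set is universal if circuits over it approximate every unitary to any precision. -/
def IsUniversal {n : ℕ} (G : Set (QUnitary n)) : Prop :=
  ∀ U : QUnitary n, ∀ δ : ℝ, 0 < δ → ∃ L : List (QUnitary n), IsCircuit G L ∧
    ApproxUpToPhase L.prod U δ

/-- `ψ` is a (normalized) ground state of `H`: a unit eigenvector for the lowest eigenvalue. -/
def IsGroundState {n : ℕ} (H : QOperator n) (ψ : QState n) : Prop :=
  star ψ ⬝ᵥ ψ = 1 ∧ ∃ E₀ : ℝ, H.mulVec ψ = (E₀ : ℂ) • ψ ∧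
    ∀ E : ℝ, Module.End.HasEigenvalue (Matrix.toLin' H) (E : ℂ) → E₀ ≤ E

/-- The bit string on all qubits that is `x` on the subsystem `A` and `z` on its complement. -/
def joinBits {n : ℕ} (A : Finset (Fin n)) (x : {i // i ∈ A} → Fin 2)
    (z : {i // i ∉ A} → Fin 2) : BitString n :=
  fun i => if h : i ∈ A then x ⟨i, h⟩ else z ⟨i, h⟩

/-- The partial trace over the complement of the set `A` of qubits. -/
def partialTrace {n : ℕ} (A : Finset (Fin n)) (ρ : QOperator n) :
    Matrix ({i // i ∈ A} → Fin 2) ({i // i ∈ A} → Fin 2) ℂ :=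
  Matrix.of fun x y => ∑ z : {i // i ∉ A} → Fin 2, ρ (joinBits A x z) (joinBits A y z)

/-- The reduced density matrix `ρ^A = Tr_B |ψ⟩⟨ψ|`, where `B` is the complement of `A`. -/
def reducedDensity {n : ℕ} (A : Finset (Fin n)) (ψ : QState n) :
    Matrix ({i // i ∈ A} → Fin 2) ({i // i ∈ A} → Fin 2) ℂ :=
  partialTrace A (Matrix.vecMulVec ψ (star ψ))

theorem reducedDensity_isHermitian {n : ℕ} (A : Finset (Fin n)) (ψ : QState n) :
    (reducedDensity A ψ).IsHermitian := by
  ext x y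
  simp [reducedDensity, partialTrace, Matrix.conjTranspose_apply, Matrix.vecMulVec_apply, mul_comm]

/-- The von Neumann entropy (in bits) of the subsystem `A` in the state `ψ`:
`S = -Tr ρ^A log₂ ρ^A = -∑ λ_i log₂ λ_i`, over the eigenvalues `λ_i` of `ρ^A` with multiplicity.
A zero eigenvalue contributes `0`. -/
noncomputable def entanglementEntropy {n : ℕ} (A : Finset (Fin n)) (ψ : QState n) : ℝ :=
  -∑ i, (reducedDensity_isHermitian A ψ).eigenvalues i *
    Real.logb 2 ((reducedDensity_isHermitian A ψ).eigenvalues i)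

open Matrix

/-! Of a ground state only its unit norm matters: any unit vector is the first column of some
unitary. Two facts remain, the Solovay–Kitaev theorem with exponent 4 and a Lipschitz bound for the
entropy.

Compactness gives a circuit length that works for all unitaries at one fixed precision.
`CircuitsApprox.improve` turns precision `ε` into `O(ε^(3/2))` at five times the length. The
residual of an approximation is, up to phase, `1 + A + O(ε²)` with `A` skew-Hermitian, traceless and
of size `O(ε)`. Such an `A` is a commutator of skew-Hermitian matrices of size `O(√ε)`, so the
residual is nearly a group commutator of unitaries at distance `O(√ε)` from `1`. Replacing these by
circuits of precision `ε` costs only `O(√ε · ε)`. Iterating gives exponent 4 because `5 ≤ (3/2)^4`.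

Although `-t log t` is not Lipschitz at `0`, `-s² log s²` is on `[0, 1]`. In an eigenbasis of one
reduced density matrix its eigenvalues are squared norms of vectors depending linearly on the state.
Dephasing the other matrix in the same basis bounds its entropy from above, so the entropy
difference is at most linear in the distance of the states. -/

/-! ### Exponentials and group commutators near the identity. -/

theorem NormedSpace.norm_exp_sub_one_sub_id_le {A : Type*} [NormedRing A] [NormedAlgebra ℂ A]
    [CompleteSpace A] {x : A} (hx : ‖x‖ ≤ 1) : ‖NormedSpace.exp x - 1 - x‖ ≤ ‖x‖ ^ 2 := by
  have hs : Summable fun k : ℕ => ((k.factorial : ℂ)⁻¹) • x ^ k :=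
    NormedSpace.expSeries_summable' (𝕂 := ℂ) x
  have h1 : NormedSpace.exp x - 1 - x = ∑' k : ℕ, (((k + 2).factorial : ℂ)⁻¹) • x ^ (k + 2) := by
    have h := hs.sum_add_tsum_nat_add 2
    rw [NormedSpace.exp_eq_tsum ℂ]
    simp only
    rw [← h]
    simp only [Finset.sum_range_succ, Finset.sum_range_zero]
    simp
    abel
  rw [h1]
  -- The tail is dominated by a geometric series of sum `‖x‖ ^ 2`, since `2 ^ (k + 1) ≤ (k + 2)!`.
  refine tsum_of_norm_bounded (hasSum_geometric_two' (‖x‖ ^ 2)) fun k => ?_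
  have hf : (2 : ℝ) * 2 ^ k ≤ ((k + 2).factorial : ℝ) := by
    have : 2 ^ (k + 1) ≤ (k + 2).factorial := by
      induction k with
      | zero => decide
      | succ k ih =>
        rw [pow_succ, Nat.factorial_succ (k + 2), mul_comm]
        exact Nat.mul_le_mul (by omega) ih
    have h2 : ((2 ^ (k + 1) : ℕ) : ℝ) ≤ ((k + 2).factorial : ℝ) := by exact_mod_cast this
    push_cast at h2
    rw [pow_succ] at h2
    linarith
  have hp : ‖x ^ (k + 2)‖ ≤ ‖x‖ ^ 2 := by
    refine (norm_pow_le' x (by omega)).trans ?_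
    exact pow_le_pow_of_le_one (norm_nonneg _) hx (by omega)
  rw [norm_smul, norm_inv, Complex.norm_natCast, inv_mul_eq_div, div_div]
  exact div_le_div₀ (by positivity) hp (by positivity) hf

/-- With `a = u - 1` and `b = v - 1`, `uv = vu + [a, b]`, so the group commutator is `1 + [a, b] u⁻¹
v⁻¹`. Dropping `u⁻¹ v⁻¹` costs the cubic term; replacing `[a, b]` by `[x, y]` costs the other two.
-/
theorem norm_groupCommutator_sub_le {A : Type*} [NormedRing A] [StarRing A] [CStarRing A]
    [Nontrivial A] (u v : unitary A) (x y : A) {f r : ℝ} (hx : ‖x‖ ≤ f) (hy : ‖y‖ ≤ f)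
    (hu : ‖(u : A) - 1 - x‖ ≤ r) (hv : ‖(v : A) - 1 - y‖ ≤ r) :
    ‖((u * v * u⁻¹ * v⁻¹ : unitary A) : A) - 1 - (x * y - y * x)‖ ≤
      4 * f * r + 2 * r ^ 2 + 4 * (f + r) ^ 3 := by
  obtain ⟨p, hp⟩ : ∃ p : A, p = (u : A) - 1 - x := ⟨_, rfl⟩
  obtain ⟨q, hq⟩ : ∃ q : A, q = (v : A) - 1 - y := ⟨_, rfl⟩
  rw [← hp] at hu
  rw [← hq] at hv
  have hu' : (u : A) = 1 + x + p := by rw [hp]; abel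
  have hv' : (v : A) = 1 + y + q := by rw [hq]; abel
  have hf : 0 ≤ f := (norm_nonneg _).trans hx
  have hr : 0 ≤ r := (norm_nonneg _).trans hu
  have huu : (u : A) * star (u : A) = 1 := Unitary.coe_mul_star_self u
  have hvv : (v : A) * star (v : A) = 1 := Unitary.coe_mul_star_self v
  set a : A := x + p with ha
  set b : A := y + q with hb
  have hua : (u : A) = 1 + a := by rw [hu', ha, add_assoc]
  have hvb : (v : A) = 1 + b := by rw [hv', hb, add_assoc]
  have hna : ‖a‖ ≤ f + r := (norm_add_le _ _).trans (add_le_add hx hu)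
  have hnb : ‖b‖ ≤ f + r := (norm_add_le _ _).trans (add_le_add hy hv)
  have hcomm : (u : A) * v = v * u + (a * b - b * a) := by rw [hua, hvb]; noncomm_ring
  have h1 : ((u * v * u⁻¹ * v⁻¹ : unitary A) : A) - 1 - (x * y - y * x) =
      (x * q + p * y + p * q - (y * p + q * x + q * p)) +
        (a * b - b * a) * (star (u : A) * star (v : A) - 1) := by
    have : ((u * v * u⁻¹ * v⁻¹ : unitary A) : A) = (u : A) * v * star (u : A) * star (v : A) := rfl
    have h2 : (v : A) * u * (star (u : A) * star (v : A)) = 1 := by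
      rw [mul_assoc, ← mul_assoc (u : A), huu, one_mul, hvv]
    rw [this, hcomm, mul_assoc, add_mul, h2, mul_sub, mul_one]
    rw [ha, hb]
    noncomm_ring
  have hsu : ‖star (u : A)‖ = 1 := by rw [norm_star, CStarRing.norm_coe_unitary]
  have h3 : ‖star (u : A) * star (v : A) - 1‖ ≤ 2 * (f + r) := by
    have : star (u : A) * star (v : A) - 1 = star (u : A) * star b + star a := by
      have h4 : star (v : A) = 1 + star b := by rw [hvb, star_add, star_one]
      have h5 : star (u : A) = 1 + star a := by rw [hua, star_add, star_one]
      rw [h4, mul_add, mul_one, h5]; abel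
    rw [this]
    refine (norm_add_le _ _).trans ?_
    have := norm_mul_le (star (u : A)) (star b)
    rw [hsu, norm_star, one_mul] at this
    rw [norm_star]
    linarith
  have bd : ∀ {s t : A} {c d : ℝ}, ‖s‖ ≤ c → ‖t‖ ≤ d → ‖s * t‖ ≤ c * d := fun hs ht =>
    (norm_mul_le _ _).trans (mul_le_mul hs ht (norm_nonneg _) ((norm_nonneg _).trans hs))
  have h6 : ‖a * b - b * a‖ ≤ 2 * (f + r) ^ 2 := by
    refine (norm_sub_le _ _).trans ?_
    have := bd hna hnb
    have := bd hnb hna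
    nlinarith
  rw [h1]
  refine (norm_add_le _ _).trans ?_
  have h7 := bd h6 h3
  have h8 : ‖x * q + p * y + p * q - (y * p + q * x + q * p)‖ ≤ 4 * f * r + 2 * r ^ 2 := by
    refine (norm_sub_le _ _).trans ?_
    have e1 := norm_add₃_le (a := x * q) (b := p * y) (c := p * q)
    have e2 := norm_add₃_le (a := y * p) (b := q * x) (c := q * p)
    have := bd hx hv
    have := bd hu hy
    have := bd hu hv
    have := bd hy hu
    have := bd hv hx
    have := bd hv hu
    nlinarith
  nlinarith

theorem Matrix.norm_entry_le_l2_opNorm {m n : Type*} [Fintype m] [Fintype n] [DecidableEq n]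
    (A : Matrix m n ℂ) (i : m) (j : n) : ‖A i j‖ ≤ ‖A‖ := by
  have h := A.l2_opNorm_mulVec (EuclideanSpace.single j 1)
  have h2 := (PiLp.norm_apply_le (p := 2) (WithLp.toLp 2 (A *ᵥ (Pi.single j (1 : ℂ)))) i).trans h
  simpa using h2

/-! ### Traceless skew-Hermitian matrices as commutators. -/

/-- The matrix of the Hadamard transform on `n` qubits. -/
noncomputable def hadamardOp (n : ℕ) : QOperator n :=
  Matrix.of fun x y => ∏ i, if x i = 1 ∧ y i = 1 then -(√2 : ℂ)⁻¹ else (√2 : ℂ)⁻¹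

theorem hadamardOp_apply (n : ℕ) (x y : BitString n) :
    hadamardOp n x y = ∏ i, if x i = 1 ∧ y i = 1 then -(((√2 : ℝ) : ℂ))⁻¹ else ((√2 : ℝ) : ℂ)⁻¹ :=
  rfl

theorem star_hadamardOp_apply (n : ℕ) (x y : BitString n) :
    star (hadamardOp n x y) = hadamardOp n x y := by
  rw [hadamardOp_apply, star_prod]
  refine Finset.prod_congr rfl fun i _ => ?_
  split_ifs <;> simp

theorem hadamardOp_mul_self_apply (n : ℕ) (x y : BitString n) :
    hadamardOp n x y * hadamardOp n x y = (2 ^ n : ℂ)⁻¹ := by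
  have h : ((√2 : ℝ) : ℂ)⁻¹ * ((√2 : ℝ) : ℂ)⁻¹ = 2⁻¹ := by
    rw [← mul_inv, ← Complex.ofReal_mul, Real.mul_self_sqrt (by norm_num)]; simp
  rw [hadamardOp_apply, ← Finset.prod_mul_distrib, Finset.prod_congr rfl (g := fun _ => (2⁻¹ : ℂ))]
  · simp
  · intro i _
    split_ifs <;> simp [h]

theorem hadamardOp_mem_unitaryGroup (n : ℕ) : hadamardOp n ∈ Matrix.unitaryGroup (BitString n) ℂ := by
  have h : ((√2 : ℝ) : ℂ)⁻¹ * ((√2 : ℝ) : ℂ)⁻¹ = 2⁻¹ := by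
    rw [← mul_inv, ← Complex.ofReal_mul, Real.mul_self_sqrt (by norm_num)]; simp
  rw [Matrix.mem_unitaryGroup_iff]
  ext x y
  have h1 : (hadamardOp n * star (hadamardOp n)) x y = ∑ z : BitString n, ∏ i,
      (if x i = 1 ∧ z i = 1 then -((√2 : ℝ) : ℂ)⁻¹ else ((√2 : ℝ) : ℂ)⁻¹) *
      (if y i = 1 ∧ z i = 1 then -((√2 : ℝ) : ℂ)⁻¹ else ((√2 : ℝ) : ℂ)⁻¹) := by
    rw [Matrix.mul_apply]
    refine Finset.sum_congr rfl fun z _ => ?_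
    rw [Matrix.star_apply, star_hadamardOp_apply, hadamardOp_apply, hadamardOp_apply,
      Finset.prod_mul_distrib]
  have h2 := (Finset.prod_univ_sum (fun _ : Fin n => (Finset.univ : Finset (Fin 2)))
    (fun i b => (if x i = 1 ∧ b = 1 then -((√2 : ℝ) : ℂ)⁻¹ else ((√2 : ℝ) : ℂ)⁻¹) *
      (if y i = 1 ∧ b = 1 then -((√2 : ℝ) : ℂ)⁻¹ else ((√2 : ℝ) : ℂ)⁻¹)))
  rw [Fintype.piFinset_univ] at h2
  rw [h1, ← h2]
  have h3 : ∀ i, (∑ b : Fin 2,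
      (if x i = 1 ∧ b = 1 then -((√2 : ℝ) : ℂ)⁻¹ else ((√2 : ℝ) : ℂ)⁻¹) *
      (if y i = 1 ∧ b = 1 then -((√2 : ℝ) : ℂ)⁻¹ else ((√2 : ℝ) : ℂ)⁻¹)) =
      if x i = y i then 1 else 0 := by
    intro i
    generalize x i = a
    generalize y i = b
    rw [Fin.sum_univ_two]
    fin_cases a <;> fin_cases b <;> simp [h] <;> norm_num
  rw [Finset.prod_congr rfl fun i _ => h3 i, Matrix.one_apply, Finset.prod_ite_zero]
  simp [funext_iff]

/-- A traceless skew-Hermitian matrix becomes hollow in a suitable orthonormal basis. -/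
theorem exists_unitary_conj_diag_eq_zero {n : ℕ} (A : QOperator n) (hA : star A = -A)
    (ht : A.trace = 0) : ∃ Q : QUnitary n, ∀ i, (star (Q : QOperator n) * A * Q) i i = 0 := by
  have hH : (Complex.I • A).IsHermitian := by
    rw [Matrix.IsHermitian, ← Matrix.star_eq_conjTranspose, star_smul, hA]; simp
  set T := hH.eigenvectorUnitary
  have hT : star (T : QOperator n) * (Complex.I • A) * (T : QOperator n) =
      diagonal (RCLike.ofReal ∘ hH.eigenvalues) := by
    rw [← hH.conjStarAlgAut_star_eigenvectorUnitary, Unitary.conjStarAlgAut_star_apply]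
  refine ⟨T * ⟨hadamardOp n, hadamardOp_mem_unitaryGroup n⟩, fun i => ?_⟩
  have h1 : Complex.I • (star ((T * ⟨hadamardOp n, hadamardOp_mem_unitaryGroup n⟩ : QUnitary n) :
      QOperator n) * A * ((T * ⟨hadamardOp n, hadamardOp_mem_unitaryGroup n⟩ : QUnitary n) :
      QOperator n)) = star (hadamardOp n) * diagonal (RCLike.ofReal ∘ hH.eigenvalues) * hadamardOp n := by
    rw [← hT]
    simp [mul_assoc]
  have h2 := congrFun (congrFun h1 i) i
  have h3 : (star (hadamardOp n) * diagonal (RCLike.ofReal ∘ hH.eigenvalues) * hadamardOp n :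
      QOperator n) i i = 0 := by
    rw [Matrix.mul_apply]
    simp only [Matrix.mul_diagonal, Matrix.star_apply, star_hadamardOp_apply]
    -- All entries of the Hadamard matrix have square `2⁻ⁿ`, so each diagonal entry is the mean of
    -- the eigenvalues, which is zero.
    have h4 : ∀ j, hadamardOp n j i * ((RCLike.ofReal ∘ hH.eigenvalues) j) * hadamardOp n j i =
        (2 ^ n : ℂ)⁻¹ * (hH.eigenvalues j : ℂ) := by
      intro j
      rw [← hadamardOp_mul_self_apply n j i]
      simp only [Function.comp_apply, Complex.coe_algebraMap]
      ring
    rw [Finset.sum_congr rfl fun j _ => h4 j, ← Finset.mul_sum]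
    have h5 := hH.trace_eq_sum_eigenvalues
    rw [Matrix.trace_smul, ht, smul_zero] at h5
    simp only [Complex.coe_algebraMap] at h5
    rw [← h5, mul_zero]
  rw [h3, Matrix.smul_apply] at h2
  simpa using h2

/-- In a basis where `A` is hollow, commuting with a diagonal `D` of distinct entries scales each
off-diagonal entry by a nonzero factor; `L` divides by these factors. `L` and `D` depend only on
`n`, hence so does `K`. On the diagonal `0⁻¹ = 0` makes `L` vanish. -/
theorem exists_commutator_eq (n : ℕ) : ∃ K : ℝ, 1 ≤ K ∧ ∀ A : QOperator n, star A = -A →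
    A.trace = 0 → ∃ F G : QOperator n, star F = -F ∧ star G = -G ∧ ‖F‖ ≤ K * ‖A‖ ∧ ‖G‖ ≤ K ∧
      F * G - G * F = A := by
  obtain ⟨g, hg⟩ : ∃ g : BitString n → ℝ, Function.Injective g :=
    ⟨fun i => ((Fintype.equivFin (BitString n) i : ℕ) : ℝ), fun i j h => by
      simpa [Fin.val_inj] using h⟩
  let L : QOperator n →ₗ[ℂ] QOperator n :=
    { toFun := fun M => Matrix.of fun j k => M j k * (Complex.I * ((g k - g j : ℝ) : ℂ))⁻¹
      map_add' := fun M N => by ext j k; simp [add_mul, add_comm]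
      map_smul' := fun c M => by ext j k; simp [mul_assoc] }
  have hL : ∀ M j k, L M j k = M j k * (Complex.I * ((g k - g j : ℝ) : ℂ))⁻¹ := fun _ _ _ => rfl
  let D : QOperator n := Matrix.diagonal fun j => Complex.I * (g j : ℂ)
  have hD : star D = -D := by
    rw [Matrix.star_eq_conjTranspose, Matrix.diagonal_conjTranspose, Matrix.diagonal_neg]
    congr 1
    ext j
    simp
  refine ⟨1 + ‖L.toContinuousLinearMap‖ + ‖D‖, by
    linarith [norm_nonneg L.toContinuousLinearMap, norm_nonneg D], fun A hA ht => ?_⟩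
  obtain ⟨Q, hQ⟩ := exists_unitary_conj_diag_eq_zero A hA ht
  set B : QOperator n := star (Q : QOperator n) * A * Q with hB
  have hQQ : (Q : QOperator n) * star (Q : QOperator n) = 1 := Unitary.coe_mul_star_self Q
  have hQQ' : star (Q : QOperator n) * (Q : QOperator n) = 1 := Unitary.coe_star_mul_self Q
  have hBs : star B = -B := by simp [hB, hA, mul_assoc]
  have hBn : ‖B‖ = ‖A‖ := by
    rw [hB, CStarRing.norm_mul_coe_unitary, ← Unitary.coe_star, CStarRing.norm_coe_unitary_mul]
  have hcomm : L B * D - D * L B = B := by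
    ext j k
    rw [Matrix.sub_apply, Matrix.mul_diagonal, Matrix.diagonal_mul, hL]
    by_cases hjk : j = k
    · subst hjk
      rw [hQ j]; simp
    · have h1 : (Complex.I * ((g k - g j : ℝ) : ℂ)) ≠ 0 := by
        refine mul_ne_zero Complex.I_ne_zero ?_
        rw [Complex.ofReal_ne_zero, sub_ne_zero]
        exact fun h => hjk (hg h).symm
      have h2 : B j k * (Complex.I * ((g k - g j : ℝ) : ℂ))⁻¹ * (Complex.I * (g k : ℂ)) -
          Complex.I * (g j : ℂ) * (B j k * (Complex.I * ((g k - g j : ℝ) : ℂ))⁻¹) =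
          B j k * ((Complex.I * ((g k - g j : ℝ) : ℂ))⁻¹ * (Complex.I * ((g k - g j : ℝ) : ℂ))) := by
        push_cast; ring
      rw [h2, inv_mul_cancel₀ h1, mul_one]
  have hLs : star (L B) = -L B := by
    ext j k
    have h1 : star (B k j) = -B j k := congrFun (congrFun hBs j) k
    rw [Matrix.star_apply, Matrix.neg_apply, hL, hL, star_mul', h1, star_inv₀, star_mul']
    have : star Complex.I * star (((g j - g k : ℝ) : ℂ)) = Complex.I * ((g k - g j : ℝ) : ℂ) := by
      simp
      ring
    rw [this, neg_mul]
  have hLn : ‖L B‖ ≤ ‖L.toContinuousLinearMap‖ * ‖A‖ := by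
    rw [← hBn]; exact L.toContinuousLinearMap.le_opNorm B
  have hconj : ∀ M : QOperator n, ‖(Q : QOperator n) * M * star (Q : QOperator n)‖ = ‖M‖ := by
    intro M
    rw [← Unitary.coe_star, CStarRing.norm_mul_coe_unitary, CStarRing.norm_coe_unitary_mul]
  refine ⟨Q * L B * star (Q : QOperator n), Q * D * star (Q : QOperator n), ?_, ?_, ?_, ?_, ?_⟩
  · simp [hLs, mul_assoc]
  · simp [hD, mul_assoc]
  · rw [hconj]
    nlinarith [norm_nonneg D, norm_nonneg A]
  · rw [hconj]
    linarith [norm_nonneg L.toContinuousLinearMap]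
  · have h1 : ∀ M N : QOperator n, (Q : QOperator n) * M * star (Q : QOperator n) *
        (Q * N * star (Q : QOperator n)) = Q * (M * N) * star (Q : QOperator n) := by
      intro M N
      calc _ = (Q : QOperator n) * M * (star (Q : QOperator n) * Q) * N * star (Q : QOperator n) := by
            noncomm_ring
        _ = _ := by rw [hQQ', mul_one]; noncomm_ring
    rw [h1, h1, ← sub_mul, ← mul_sub, hcomm, hB]
    calc _ = ((Q : QOperator n) * star (Q : QOperator n)) * A *
          ((Q : QOperator n) * star (Q : QOperator n)) := by noncomm_ring
      _ = A := by rw [hQQ, one_mul, mul_one]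

/-! ### Unitaries near the identity, up to phase. -/

theorem smul_mem_unitaryGroup {ι : Type*} [Fintype ι] [DecidableEq ι] {z : ℂ} (hz : ‖z‖ = 1)
    (U : Matrix.unitaryGroup ι ℂ) : z • (U : Matrix ι ι ℂ) ∈ Matrix.unitaryGroup ι ℂ := by
  have hzz : z * star z = 1 := by
    rw [Complex.star_def, Complex.mul_conj, Complex.normSq_eq_norm_sq, hz]; simp
  rw [Matrix.mem_unitaryGroup_iff, star_smul, smul_mul_smul_comm, hzz, one_smul]
  exact Unitary.coe_mul_star_self U

/-- The skew part `A'` of `d` misses `d - 1` by exactly `-(d - 1)(d - 1)* / 2`, which is of second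
order. Commutators are traceless, so the mean `τ` of the diagonal, purely imaginary, is absorbed
into the phase `exp (-τ)`. -/
theorem exists_phase_eq_one_add_skew {ι : Type*} [Fintype ι] [DecidableEq ι] [Nonempty ι]
    (D : Matrix.unitaryGroup ι ℂ) {ε : ℝ} (hε1 : ε ≤ 1) (hD : ‖(D : Matrix ι ι ℂ) - 1‖ ≤ ε) :
    ∃ w : ℂ, ‖w‖ = 1 ∧ ∃ A : Matrix ι ι ℂ, star A = -A ∧ A.trace = 0 ∧ ‖A‖ ≤ 2 * ε ∧
      ‖w • (D : Matrix ι ι ℂ) - 1 - A‖ ≤ 3 * ε ^ 2 := by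
  have hε : 0 ≤ ε := (norm_nonneg _).trans hD
  set d : Matrix ι ι ℂ := (D : Matrix ι ι ℂ) with hd
  have hdd : d * star d = 1 := Unitary.coe_mul_star_self D
  have hdn : ‖d‖ = 1 := CStarRing.norm_coe_unitary D
  set A' : Matrix ι ι ℂ := (2⁻¹ : ℂ) • (d - star d) with hA'
  have hA's : star A' = -A' := by
    rw [hA', star_smul, star_sub, star_star, ← smul_neg, neg_sub]; simp
  have hA'n : ‖A'‖ ≤ ε := by
    have h1 : d - star d = (d - 1) - star (d - 1) := by rw [star_sub, star_one]; abel
    have h2 : ‖d - star d‖ ≤ 2 * ε := by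
      rw [h1]
      refine (norm_sub_le _ _).trans ?_
      rw [norm_star]; linarith
    rw [hA', norm_smul, norm_inv]
    norm_num
    linarith
  have hR : ‖d - 1 - A'‖ ≤ ε ^ 2 := by
    have h1 : d - 1 - A' = (-2⁻¹ : ℂ) • ((d - 1) * star (d - 1)) := by
      have h2 : (d - 1) * star (d - 1) = (2 : ℂ) • 1 - d - star d := by
        rw [star_sub, star_one, sub_mul, mul_sub, hdd, mul_one, one_mul, two_smul]; abel
      rw [h2, hA']
      module
    rw [h1, norm_smul, CStarRing.norm_self_mul_star]
    have : ‖d - 1‖ * ‖d - 1‖ ≤ ε * ε := mul_le_mul hD hD (norm_nonneg _) hε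
    have h3 : ‖(-2⁻¹ : ℂ)‖ = 2⁻¹ := by simp
    rw [h3]
    nlinarith [norm_nonneg (d - 1)]
  clear_value A'
  set τ : ℂ := A'.trace / (Fintype.card ι : ℂ) with hτ
  have hN : (Fintype.card ι : ℂ) ≠ 0 := by simp
  have hτs : star τ = -τ := by
    have h1 : star A'.trace = -A'.trace := by
      rw [← Matrix.trace_conjTranspose, ← Matrix.star_eq_conjTranspose, hA's, Matrix.trace_neg]
    rw [hτ, star_div₀, h1, star_natCast, neg_div]
  have hτn : ‖τ‖ ≤ ε := by
    rw [hτ, norm_div, Complex.norm_natCast, div_le_iff₀ (by positivity)]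
    refine (norm_sum_le _ _).trans ((Finset.sum_le_sum fun i _ =>
      (A'.norm_entry_le_l2_opNorm i i).trans hA'n).trans ?_)
    simp [mul_comm]
  have hτre : τ.re = 0 := by
    have := congrArg Complex.re hτs
    simp at this
    linarith
  refine ⟨Complex.exp (-τ), by rw [Complex.norm_exp]; simp [hτre], A' - τ • 1, ?_, ?_, ?_, ?_⟩
  · rw [star_sub, hA's, star_smul, hτs, star_one]
    module
  · rw [Matrix.trace_sub, Matrix.trace_smul, Matrix.trace_one, hτ, smul_eq_mul,
      div_mul_cancel₀ _ hN, sub_self]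
  · refine (norm_sub_le _ _).trans ?_
    rw [norm_smul, CStarRing.norm_one]
    linarith
  · have h1 : Complex.exp (-τ) • d - 1 - (A' - τ • (1 : Matrix ι ι ℂ)) =
        (d - 1 - A') - τ • (d - 1) + (Complex.exp (-τ) - 1 - -τ) • d := by module
    rw [h1]
    have h2 : ‖Complex.exp (-τ) - 1 - -τ‖ ≤ ε ^ 2 := by
      refine (Complex.norm_exp_sub_one_sub_id_le (by rw [norm_neg]; linarith)).trans ?_
      rw [norm_neg]
      exact pow_le_pow_left₀ (norm_nonneg _) hτn 2
    refine (norm_add_le _ _).trans ?_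
    have h3 := norm_sub_le (d - 1 - A') (τ • (d - 1))
    rw [norm_smul] at h3 ⊢
    rw [hdn]
    have h4 : ‖τ‖ * ‖d - 1‖ ≤ ε * ε := mul_le_mul hτn hD (norm_nonneg _) hε
    nlinarith

/-! ### The Solovay–Kitaev recursion. -/

/-- Every unitary is approximated up to phase with precision `ε` by a circuit of at most `l`
gates of `G`. -/
def CircuitsApprox {n : ℕ} (G : Set (QUnitary n)) (l : ℕ) (ε : ℝ) : Prop :=
  ∀ U : QUnitary n, ∃ L : List (QUnitary n), IsCircuit G L ∧ L.length ≤ l ∧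
    ApproxUpToPhase L.prod U ε

/-- Universality alone lets the length depend on `U`; a finite `δ / 2`-net of the unitary group
makes it uniform. -/
theorem IsUniversal.exists_circuitsApprox {n : ℕ} {G : Set (QUnitary n)} (hG : IsUniversal G)
    {δ : ℝ} (hδ : 0 < δ) : ∃ l, CircuitsApprox G l δ := by
  have htb : TotallyBounded (Set.range fun U : QUnitary n => (U : QOperator n)) := by
    have : ProperSpace (QOperator n) := FiniteDimensional.proper ℂ _
    refine (isCompact_closedBall (0 : QOperator n) 1).totallyBounded.subset ?_
    rintro _ ⟨U, rfl⟩
    simp [CStarRing.norm_coe_unitary]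
  obtain ⟨t, hts, htf, hcov⟩ := Metric.finite_approx_of_totallyBounded htb (δ / 2) (by linarith)
  choose f hf using fun U => hG U (δ / 2) (by linarith)
  have htf' : ((fun U : QUnitary n => (U : QOperator n)) ⁻¹' t).Finite :=
    htf.preimage Subtype.val_injective.injOn
  refine ⟨htf'.toFinset.sup fun U => (f U).length, fun U => ?_⟩
  obtain ⟨y, hy, hUy⟩ := Set.mem_iUnion₂.1 (hcov ⟨U, rfl⟩)
  obtain ⟨Y, rfl⟩ := hts hy
  obtain ⟨hc, z, hz, hn⟩ := hf Y
  refine ⟨f Y, hc, Finset.le_sup (f := fun U => (f U).length) (htf'.mem_toFinset.2 hy), z, hz, ?_⟩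
  have h1 : ((f Y).prod : QOperator n) - z • (U : QOperator n) =
      (((f Y).prod : QOperator n) - z • (Y : QOperator n)) -
        z • ((U : QOperator n) - (Y : QOperator n)) := by module
  rw [h1]
  refine (norm_sub_le _ _).trans ?_
  rw [Metric.mem_ball, dist_eq_norm] at hUy
  rw [norm_smul, hz, one_mul]
  linarith

theorem IsCircuit.append {n : ℕ} {G : Set (QUnitary n)} {L M : List (QUnitary n)}
    (hL : IsCircuit G L) (hM : IsCircuit G M) : IsCircuit G (L ++ M) := by
  intro g hg
  rcases List.mem_append.1 hg with h | h
  exacts [hL g h, hM g h]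

theorem IsCircuit.exists_inv {n : ℕ} {G : Set (QUnitary n)} (hinv : ∀ g ∈ G, g⁻¹ ∈ G)
    {L : List (QUnitary n)} (hL : IsCircuit G L) :
    ∃ M, IsCircuit G M ∧ M.length = L.length ∧ M.prod = L.prod⁻¹ := by
  refine ⟨(L.map (·⁻¹)).reverse, ?_, by simp, (List.prod_inv_reverse L).symm⟩
  intro g hg
  simp only [List.mem_reverse, List.mem_map] at hg
  obtain ⟨h, hh, rfl⟩ := hg
  exact hinv h (hL h hh)

/-- Each phase meets its conjugate, so circuits known only up to phase still have a definite group
commutator. -/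
theorem coe_groupCommutator_smul {ι : Type*} [Fintype ι] [DecidableEq ι]
    (U V : Matrix.unitaryGroup ι ℂ) {z w : ℂ} (hz : ‖z‖ = 1) (hw : ‖w‖ = 1) :
    (⟨z • (U : Matrix ι ι ℂ), smul_mem_unitaryGroup hz U⟩ : Matrix.unitaryGroup ι ℂ) *
      ⟨w • (V : Matrix ι ι ℂ), smul_mem_unitaryGroup hw V⟩ *
      (⟨z • (U : Matrix ι ι ℂ), smul_mem_unitaryGroup hz U⟩ : Matrix.unitaryGroup ι ℂ)⁻¹ *
      (⟨w • (V : Matrix ι ι ℂ), smul_mem_unitaryGroup hw V⟩ : Matrix.unitaryGroup ι ℂ)⁻¹ =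
      U * V * U⁻¹ * V⁻¹ := by
  have key : ∀ {z : ℂ}, ‖z‖ = 1 → z * star z = 1 := fun {z} hz => by
    rw [Complex.star_def, Complex.mul_conj, Complex.normSq_eq_norm_sq, hz]; simp
  apply Subtype.ext
  change z • (U : Matrix ι ι ℂ) * w • (V : Matrix ι ι ℂ) * star (z • (U : Matrix ι ι ℂ)) *
    star (w • (V : Matrix ι ι ℂ)) = (U : Matrix ι ι ℂ) * V * star (U : Matrix ι ι ℂ) *
    star (V : Matrix ι ι ℂ)
  rw [star_smul, star_smul, smul_mul_smul_comm, smul_mul_smul_comm, smul_mul_smul_comm]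
  have : z * w * star z * star w = 1 := by
    calc _ = (z * star z) * (w * star w) := by ring
      _ = 1 := by rw [key hz, key hw, one_mul]
  rw [this, one_smul]

/-- The circuit approximates the unitary `exp F`: linearizing costs `f ^ 2`, the circuit costs `ε`.
-/
theorem CircuitsApprox.exists_near_one_add {n : ℕ} {G : Set (QUnitary n)} {l : ℕ} {ε f : ℝ}
    (h : CircuitsApprox G l ε) {F : QOperator n} (hF : star F = -F) (hFf : ‖F‖ ≤ f) (hf : f ≤ 1) :
    ∃ L : List (QUnitary n), IsCircuit G L ∧ L.length ≤ l ∧ ∃ z : ℂ, ‖z‖ = 1 ∧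
      ‖z • (L.prod : QOperator n) - 1 - F‖ ≤ f ^ 2 + ε := by
  have hu : NormedSpace.exp F ∈ unitary (QOperator n) :=
    letI := NormedAlgebra.restrictScalars ℚ ℂ (QOperator n)
    NormedSpace.exp_mem_unitary_of_mem_skewAdjoint (skewAdjoint.mem_iff.2 hF)
  obtain ⟨L, hL, hl, z, hz, hn⟩ := h ⟨NormedSpace.exp F, hu⟩
  have hzz : star z * z = 1 := by
    rw [mul_comm, Complex.star_def, Complex.mul_conj, Complex.normSq_eq_norm_sq, hz]; simp
  refine ⟨L, hL, hl, star z, by rw [norm_star, hz], ?_⟩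
  have h1 : star z • (L.prod : QOperator n) - 1 - F =
      (NormedSpace.exp F - 1 - F) +
        star z • ((L.prod : QOperator n) - z • NormedSpace.exp F) := by
    rw [smul_sub, smul_smul, hzz, one_smul]; abel
  rw [h1]
  refine (norm_add_le _ _).trans ?_
  rw [norm_smul, norm_star, hz, one_mul]
  refine add_le_add ((NormedSpace.norm_exp_sub_one_sub_id_le (hFf.trans hf)).trans ?_) hn
  exact pow_le_pow_left₀ (norm_nonneg _) hFf 2

theorem commutator_error_le {K s : ℝ} (hK : 1 ≤ K) (hs : 0 ≤ s) (hKs : 2 * K * s ≤ 1) :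
    4 * (2 * K * s) * (5 * K ^ 2 * s ^ 2) + 2 * (5 * K ^ 2 * s ^ 2) ^ 2 +
      4 * (2 * K * s + 5 * K ^ 2 * s ^ 2) ^ 3 + 3 * (s ^ 2) ^ 2 ≤ 2000 * K ^ 6 * s ^ 3 := by
  have hs1 : s ≤ 1 := by nlinarith
  have k3 : K ^ 3 ≤ K ^ 6 := pow_le_pow_right₀ hK (by norm_num)
  have k4 : K ^ 4 ≤ K ^ 6 := pow_le_pow_right₀ hK (by norm_num)
  have k6 : 1 ≤ K ^ 6 := one_le_pow₀ hK
  have k2 : K ≤ K ^ 2 := le_self_pow₀ hK (by norm_num)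
  have hs3 : 0 ≤ s ^ 3 := by positivity
  have hs4 : s ^ 4 ≤ s ^ 3 := pow_le_pow_of_le_one hs hs1 (by norm_num)
  have e1 : 4 * (2 * K * s) * (5 * K ^ 2 * s ^ 2) ≤ 40 * (K ^ 6 * s ^ 3) := by
    have := mul_le_mul_of_nonneg_right k3 hs3
    linarith
  have e2 : 2 * (5 * K ^ 2 * s ^ 2) ^ 2 ≤ 50 * (K ^ 6 * s ^ 3) := by
    have := mul_le_mul k4 hs4 (by positivity) (by positivity)
    linarith
  have e3 : 4 * (2 * K * s + 5 * K ^ 2 * s ^ 2) ^ 3 ≤ 1372 * (K ^ 6 * s ^ 3) := by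
    have h2 : 2 * K * s + 5 * K ^ 2 * s ^ 2 ≤ 7 * (K ^ 2 * s) := by
      have a1 := mul_le_mul_of_nonneg_right k2 hs
      have a2 : K ^ 2 * s ^ 2 ≤ K ^ 2 * s :=
        mul_le_mul_of_nonneg_left (by nlinarith) (by positivity)
      linarith
    have h3 := pow_le_pow_left₀ (by positivity) h2 3
    linarith
  have e4 : 3 * (s ^ 2) ^ 2 ≤ 3 * (K ^ 6 * s ^ 3) := by
    have := mul_le_mul_of_nonneg_right k6 hs3
    linarith
  have e5 : 0 ≤ K ^ 6 * s ^ 3 := by positivity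
  linarith

theorem CircuitsApprox.improve (n : ℕ) : ∃ C : ℝ, 1 ≤ C ∧ ∀ (G : Set (QUnitary n)),
    (∀ g ∈ G, g⁻¹ ∈ G) → ∀ (l : ℕ) (ε : ℝ), 0 < ε → C ^ 2 * ε ≤ 1 → CircuitsApprox G l ε →
      CircuitsApprox G (5 * l) (C * (ε * √ε)) := by
  obtain ⟨K, hK, hKA⟩ := exists_commutator_eq n
  have hK6 : 1 ≤ K ^ 6 := one_le_pow₀ hK
  refine ⟨2000 * K ^ 6, by linarith, fun G hinv l ε hε hCε happ U => ?_⟩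
  obtain ⟨s, hs, rfl⟩ : ∃ s : ℝ, 0 < s ∧ ε = s ^ 2 :=
    ⟨√ε, Real.sqrt_pos.2 hε, (Real.sq_sqrt hε.le).symm⟩
  rw [Real.sqrt_sq hs.le]
  have hsK : 2000 * K ^ 6 * s ≤ 1 := by
    by_contra! h
    nlinarith
  have hKK : K ≤ K ^ 6 := le_self_pow₀ hK (by norm_num)
  have hf1 : 2 * K * s ≤ 1 := by nlinarith
  have hs1 : s ≤ 1 := by nlinarith
  obtain ⟨L₀, hL₀, hl₀, z, hz, hU⟩ := happ U
  let D : QUnitary n := ⟨z • ((U * L₀.prod⁻¹ : QUnitary n) : QOperator n),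
    smul_mem_unitaryGroup hz _⟩
  have hDL : (D : QOperator n) * L₀.prod = z • (U : QOperator n) := by
    change (z • ((U : QOperator n) * star (L₀.prod : QOperator n))) * (L₀.prod : QOperator n) = _
    rw [smul_mul_assoc, mul_assoc, Unitary.coe_star_mul_self, mul_one]
  have hD1 : ‖(D : QOperator n) - 1‖ ≤ s ^ 2 := by
    rw [← CStarRing.norm_mul_coe_unitary _ L₀.prod, sub_mul, hDL, one_mul, norm_sub_rev]
    exact hU
  obtain ⟨w, hw, A, hAs, hAt, hAn, hA⟩ :=
    exists_phase_eq_one_add_skew D (pow_le_one₀ hs.le hs1) hD1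
  obtain ⟨F, H, hFs, hHs, hFn, hHn, hFH⟩ := hKA A hAs hAt
  have hsC : (s : ℂ) ≠ 0 := by exact_mod_cast hs.ne'
  -- Here `‖F‖ ≤ 2 * K * s ^ 2` and `‖H‖ ≤ K`. Scaling by `s⁻¹` and `s` keeps the commutator and
  -- balances both norms to at most `2 * K * s`.
  obtain ⟨LV, hLV, hlV, v, hv, hV⟩ := happ.exists_near_one_add (F := (s : ℂ)⁻¹ • F)
    (f := 2 * K * s) (by rw [star_smul, hFs]; simp) (by
      rw [norm_smul, norm_inv, Complex.norm_real, Real.norm_of_nonneg hs.le,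
        inv_mul_le_iff₀ hs]
      nlinarith) hf1
  obtain ⟨LW, hLW, hlW, y, hy, hW⟩ := happ.exists_near_one_add (F := (s : ℂ) • H)
    (f := 2 * K * s) (by rw [star_smul, hHs]; simp) (by
      rw [norm_smul, Complex.norm_real, Real.norm_of_nonneg hs.le]
      nlinarith) hf1
  obtain ⟨LV', hLV', hlV', hpV⟩ := hLV.exists_inv hinv
  obtain ⟨LW', hLW', hlW', hpW⟩ := hLW.exists_inv hinv
  refine ⟨LV ++ LW ++ LV' ++ LW' ++ L₀,
    (((hLV.append hLW).append hLV').append hLW').append hL₀, ?_, w * z, by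
      rw [norm_mul, hw, hz, one_mul], ?_⟩
  · simp only [List.length_append]
    omega
  -- The value of `r` bounds `(2 * K * s) ^ 2 + s ^ 2`, using `1 ≤ K`.
  have hcomm := norm_groupCommutator_sub_le
    (⟨v • (LV.prod : QOperator n), smul_mem_unitaryGroup hv _⟩ : QUnitary n)
    (⟨y • (LW.prod : QOperator n), smul_mem_unitaryGroup hy _⟩ : QUnitary n)
    ((s : ℂ)⁻¹ • F) ((s : ℂ) • H) (f := 2 * K * s) (r := 5 * K ^ 2 * s ^ 2) (by
      rw [norm_smul, norm_inv, Complex.norm_real, Real.norm_of_nonneg hs.le,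
        inv_mul_le_iff₀ hs]
      nlinarith) (by
      rw [norm_smul, Complex.norm_real, Real.norm_of_nonneg hs.le]
      nlinarith) (hV.trans (by nlinarith [one_le_pow₀ hK (n := 2), sq_nonneg s]))
      (hW.trans (by nlinarith [one_le_pow₀ hK (n := 2), sq_nonneg s]))
  rw [coe_groupCommutator_smul _ _ hv hy, smul_mul_smul_comm, smul_mul_smul_comm,
    inv_mul_cancel₀ hsC, mul_inv_cancel₀ hsC, one_smul, one_smul, hFH] at hcomm
  simp only [List.prod_append, hpV, hpW]
  set P : QUnitary n := LV.prod * LW.prod * LV.prod⁻¹ * LW.prod⁻¹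
  have h1 : ((P * L₀.prod : QUnitary n) : QOperator n) - (w * z) • (U : QOperator n) =
      (((P : QOperator n) - 1 - A) - (w • (D : QOperator n) - 1 - A)) * (L₀.prod : QOperator n) := by
    rw [mul_smul, ← hDL, ← smul_mul_assoc, sub_sub_sub_cancel_right, sub_sub_sub_cancel_right,
      sub_mul]
    rfl
  rw [h1, CStarRing.norm_mul_coe_unitary]
  refine (norm_sub_le _ _).trans ((add_le_add hcomm hA).trans ?_)
  calc _ ≤ 2000 * K ^ 6 * s ^ 3 := commutator_error_le hK hs.le hf1
    _ = _ := by ring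

/-- For the normalized error `e = C ^ 2 * ε` one improvement is just `e ↦ e ^ (3 / 2)`, started at
`1 / 2`. -/
theorem CircuitsApprox.iterate {n : ℕ} {G : Set (QUnitary n)} {C : ℝ} (hC : 1 ≤ C)
    (hstep : ∀ (l : ℕ) (ε : ℝ), 0 < ε → C ^ 2 * ε ≤ 1 → CircuitsApprox G l ε →
      CircuitsApprox G (5 * l) (C * (ε * √ε))) {l : ℕ}
    (h : CircuitsApprox G l ((1 / 2) / C ^ 2)) (k : ℕ) :
    CircuitsApprox G (5 ^ k * l) ((1 / 2 : ℝ) ^ ((3 / 2 : ℝ) ^ k) / C ^ 2) := by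
  induction k with
  | zero => simpa using h
  | succ k ih =>
    set e : ℝ := (1 / 2 : ℝ) ^ ((3 / 2 : ℝ) ^ k) with he
    have he0 : 0 < e := Real.rpow_pos_of_pos (by norm_num) _
    have he1 : e ≤ 1 := Real.rpow_le_one (by norm_num) (by norm_num) (by positivity)
    have h1 := hstep _ _ (by positivity) (by rwa [mul_div_cancel₀ _ (by positivity)]) ih
    have h2 : C * (e / C ^ 2 * √(e / C ^ 2)) =
        (1 / 2 : ℝ) ^ ((3 / 2 : ℝ) ^ (k + 1)) / C ^ 2 := by
      have h3 : (1 / 2 : ℝ) ^ ((3 / 2 : ℝ) ^ (k + 1)) = e * √e := by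
        rw [pow_succ, Real.rpow_mul (by norm_num), ← he, Real.sqrt_eq_rpow]
        nth_rw 2 [← Real.rpow_one e]
        rw [← Real.rpow_add he0]
        norm_num
      rw [h3, Real.sqrt_div he0.le, Real.sqrt_sq (by linarith)]
      field_simp
    rw [h2, ← mul_assoc, ← pow_succ'] at h1
    exact h1

/-- The Solovay–Kitaev theorem, with exponent `4`. -/
theorem IsUniversal.exists_length_le {n : ℕ} {G : Set (QUnitary n)} (hG : IsUniversal G)
    (hinv : ∀ g ∈ G, g⁻¹ ∈ G) : ∃ C : ℝ, 0 < C ∧ ∀ (U : QUnitary n) (ε : ℝ), 0 < ε → ε ≤ 1 / 2 →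
      ∃ L : List (QUnitary n), IsCircuit G L ∧ (L.length : ℝ) ≤ C * Real.log (1 / ε) ^ 4 ∧
        ApproxUpToPhase L.prod U ε := by
  obtain ⟨C, hC, hstep⟩ := CircuitsApprox.improve n
  obtain ⟨l, hl⟩ := hG.exists_circuitsApprox (δ := (1 / 2) / C ^ 2) (by positivity)
  have hlog2 : 0 < Real.log 2 := Real.log_pos (by norm_num)
  refine ⟨(81 / 16) * (l + 1) / Real.log 2 ^ 4, by positivity, fun U ε hε hε2 => ?_⟩
  have hx : 1 ≤ Real.log (1 / ε) / Real.log 2 := by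
    rw [one_le_div hlog2]
    refine Real.log_le_log (by norm_num) ?_
    rw [le_div_iff₀ hε]; linarith
  -- `(3 / 2) ^ k` is at most `log₂ (1 / ε)` and `(3 / 2) ^ (k + 1)` exceeds it: `k + 1` rounds
  -- reach precision `ε`, and the first bound controls their cost.
  obtain ⟨k, hk1, hk2⟩ := exists_nat_pow_near hx (y := 3 / 2) (by norm_num)
  obtain ⟨L, hL, hlen, z, hz, hn⟩ := CircuitsApprox.iterate hC (hstep G hinv) hl (k + 1) U
  refine ⟨L, hL, ?_, z, hz, hn.trans ?_⟩
  · have h1 : (L.length : ℝ) ≤ 5 ^ (k + 1) * l := by exact_mod_cast hlen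
    have h2 : (5 : ℝ) ^ (k + 1) ≤ (81 / 16) * (Real.log (1 / ε) / Real.log 2) ^ 4 := by
      calc (5 : ℝ) ^ (k + 1) ≤ ((3 / 2) ^ 4) ^ (k + 1) :=
            pow_le_pow_left₀ (by norm_num) (by norm_num) _
        _ = (81 / 16) * ((3 / 2) ^ k) ^ 4 := by
            rw [← pow_mul, ← pow_mul, show 4 * (k + 1) = 4 + k * 4 by ring, pow_add]
            norm_num
        _ ≤ _ := by gcongr
    calc (L.length : ℝ) ≤ 5 ^ (k + 1) * l := h1
      _ ≤ (81 / 16) * (Real.log (1 / ε) / Real.log 2) ^ 4 * (l + 1) := by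
          gcongr
          linarith
      _ = _ := by rw [div_pow]; ring
  · refine (div_le_self (by positivity) (one_le_pow₀ hC)).trans ?_
    rw [Real.rpow_le_iff_le_log (by norm_num) hε]
    rw [div_lt_iff₀ hlog2] at hk2
    have e1 : Real.log (1 / ε) = -Real.log ε := by rw [one_div, Real.log_inv]
    have e2 : Real.log (1 / 2) = -Real.log 2 := by rw [one_div, Real.log_inv]
    rw [e1] at hk2
    rw [e2]
    linarith

/-! ### Lipschitz continuity of the entanglement entropy. -/

/-- Squaring tames the singularity at `0`, because `s log s` is bounded on `(0, 1]`. This is why the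
final entropy error has no logarithmic factor. -/
theorem abs_negMulLog_sq_sub_le {s t : ℝ} (hs : 0 ≤ s) (hs1 : s ≤ 1) (ht : 0 ≤ t) (ht1 : t ≤ 1) :
    |Real.negMulLog (s ^ 2) - Real.negMulLog (t ^ 2)| ≤ 6 * |s - t| := by
  wlog hts : t ≤ s generalizing s t
  · rw [abs_sub_comm, abs_sub_comm s]
    exact this ht ht1 hs hs1 (le_of_not_ge hts)
  have hlog : ∀ r : ℝ, 0 < r → r ≤ 1 → |r * Real.log r| ≤ 1 := fun r h0 h1 => by
    rw [mul_comm]; exact (Real.abs_log_mul_self_lt r h0 h1).le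
  rcases hs.eq_or_lt with rfl | hs0
  · obtain rfl : t = 0 := le_antisymm hts ht
    simp
  rw [abs_of_nonneg (sub_nonneg.2 hts)]
  have h1 : Real.negMulLog (s ^ 2) - Real.negMulLog (t ^ 2) =
      -2 * ((s - t) * ((s + t) * Real.log s) + t ^ 2 * (Real.log s - Real.log t)) := by
    simp only [Real.negMulLog, Real.log_pow]
    push_cast
    ring
  have h2 : |(s + t) * Real.log s| ≤ 2 := by
    have h3 := hlog s hs0 hs1
    rw [abs_mul, abs_of_pos hs0] at h3
    rw [abs_mul, abs_of_nonneg (by linarith)]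
    nlinarith [abs_nonneg (Real.log s)]
  have h4 : |t ^ 2 * (Real.log s - Real.log t)| ≤ s - t := by
    rcases ht.eq_or_lt with rfl | ht0
    · simpa using hs
    · rw [← Real.log_div hs0.ne' ht0.ne', abs_mul, abs_of_nonneg (sq_nonneg t),
        abs_of_nonneg (Real.log_nonneg ((one_le_div ht0).2 hts))]
      have h5 := Real.log_le_sub_one_of_pos (div_pos hs0 ht0)
      calc t ^ 2 * Real.log (s / t) ≤ t ^ 2 * (s / t - 1) := by gcongr
        _ = t * (s - t) := by field_simp
        _ ≤ 1 * (s - t) := mul_le_mul_of_nonneg_right ht1 (sub_nonneg.2 hts)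
        _ = s - t := one_mul _
  rw [h1, abs_mul]
  have h6 : |(s - t) * ((s + t) * Real.log s)| ≤ (s - t) * 2 := by
    rw [abs_mul, abs_of_nonneg (sub_nonneg.2 hts)]
    exact mul_le_mul_of_nonneg_left h2 (sub_nonneg.2 hts)
  have h7 := abs_add_le ((s - t) * ((s + t) * Real.log s)) (t ^ 2 * (Real.log s - Real.log t))
  norm_num
  linarith

theorem Matrix.unitaryGroup.sum_norm_sq_col {ι : Type*} [Fintype ι] [DecidableEq ι]
    (Q : Matrix.unitaryGroup ι ℂ) (i : ι) : ∑ j, ‖(Q : Matrix ι ι ℂ) j i‖ ^ 2 = 1 := by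
  have h := congrFun (congrFun (Matrix.mem_unitaryGroup_iff'.1 Q.2) i) i
  rw [Matrix.mul_apply, Matrix.one_apply_eq] at h
  simp only [Matrix.star_apply, Complex.star_def, Complex.conj_mul'] at h
  exact_mod_cast h

theorem Matrix.unitaryGroup.sum_norm_sq_row {ι : Type*} [Fintype ι] [DecidableEq ι]
    (Q : Matrix.unitaryGroup ι ℂ) (i : ι) : ∑ j, ‖(Q : Matrix ι ι ℂ) i j‖ ^ 2 = 1 := by
  have h := congrFun (congrFun (Matrix.mem_unitaryGroup_iff.1 Q.2) i) i
  rw [Matrix.mul_apply, Matrix.one_apply_eq] at h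
  simp only [Matrix.star_apply, Complex.star_def, Complex.mul_conj'] at h
  exact_mod_cast h

theorem Matrix.IsHermitian.star_eigenvectorUnitary_mul_mul {ι : Type*} [Fintype ι] [DecidableEq ι]
    {ρ : Matrix ι ι ℂ} (hρ : ρ.IsHermitian) :
    star (hρ.eigenvectorUnitary : Matrix ι ι ℂ) * ρ * (hρ.eigenvectorUnitary : Matrix ι ι ℂ) =
      diagonal (fun i => (hρ.eigenvalues i : ℂ)) := by
  have h := hρ.conjStarAlgAut_star_eigenvectorUnitary
  rw [Unitary.conjStarAlgAut_star_apply] at h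
  exact h

open ComplexOrder in
/-- Dephasing in an orthonormal basis does not decrease the entropy. -/
theorem Matrix.PosSemidef.sum_negMulLog_eigenvalues_le {ι : Type*} [Fintype ι] [DecidableEq ι]
    {ρ : Matrix ι ι ℂ} (hρ : ρ.PosSemidef) (W : Matrix.unitaryGroup ι ℂ) :
    ∑ j, Real.negMulLog (hρ.isHermitian.eigenvalues j) ≤
      ∑ i, Real.negMulLog (((star (W : Matrix ι ι ℂ) * ρ * (W : Matrix ι ι ℂ)) i i).re) := by
  set V := hρ.isHermitian.eigenvectorUnitary with hV
  set Q : Matrix.unitaryGroup ι ℂ := V⁻¹ * W with hQ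
  have hVQ : (W : Matrix ι ι ℂ) = (V : Matrix ι ι ℂ) * (Q : Matrix ι ι ℂ) := by
    have : W = V * Q := by rw [hQ, mul_inv_cancel_left]
    exact congrArg Subtype.val this
  have hdiag : ∀ i, ((star (W : Matrix ι ι ℂ) * ρ * (W : Matrix ι ι ℂ)) i i).re =
      ∑ j, ‖(Q : Matrix ι ι ℂ) j i‖ ^ 2 * hρ.isHermitian.eigenvalues j := by
    intro i
    have h1 : star (W : Matrix ι ι ℂ) * ρ * (W : Matrix ι ι ℂ) = star (Q : Matrix ι ι ℂ) *
        diagonal (fun i => (hρ.isHermitian.eigenvalues i : ℂ)) * (Q : Matrix ι ι ℂ) := by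
      rw [← hρ.isHermitian.star_eigenvectorUnitary_mul_mul, hVQ, star_mul]
      simp only [mul_assoc]
      rfl
    rw [h1, Matrix.mul_apply, Complex.re_sum]
    refine Finset.sum_congr rfl fun j _ => ?_
    rw [Matrix.mul_diagonal, Matrix.star_apply, mul_right_comm, Complex.star_def,
      Complex.conj_mul', ← Complex.ofReal_pow, ← Complex.ofReal_mul, Complex.ofReal_re]
  -- The numbers `‖Q j i‖ ^ 2` are doubly stochastic: rows summing to `1` redistribute the left
  -- side, columns summing to `1` allow Jensen's inequality.
  calc ∑ j, Real.negMulLog (hρ.isHermitian.eigenvalues j)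
      = ∑ j, (∑ i, ‖(Q : Matrix ι ι ℂ) j i‖ ^ 2) *
          Real.negMulLog (hρ.isHermitian.eigenvalues j) := by
        simp_rw [Matrix.unitaryGroup.sum_norm_sq_row, one_mul]
    _ = ∑ i, ∑ j, ‖(Q : Matrix ι ι ℂ) j i‖ ^ 2 *
          Real.negMulLog (hρ.isHermitian.eigenvalues j) := by
        simp_rw [Finset.sum_mul]
        exact Finset.sum_comm
    _ ≤ _ := by
        refine Finset.sum_le_sum fun i _ => ?_
        rw [hdiag i]
        exact Real.concaveOn_negMulLog.le_map_sum (fun j _ => sq_nonneg _)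
          (Matrix.unitaryGroup.sum_norm_sq_col Q i) (fun j _ => hρ.eigenvalues_nonneg j)

/-- The amplitudes of the complement of `A` relative to the `i`-th column of `W`, a vector of the
subsystem `A`. -/
noncomputable def relativeState {n : ℕ} (A : Finset (Fin n))
    (W : Matrix ({i // i ∈ A} → Fin 2) ({i // i ∈ A} → Fin 2) ℂ) (ψ : QState n)
    (i : {i // i ∈ A} → Fin 2) : EuclideanSpace ℂ ({i // i ∉ A} → Fin 2) :=
  WithLp.toLp 2 fun z => ∑ x, star (W x i) * ψ (joinBits A x z)

theorem relativeState_sub {n : ℕ} (A : Finset (Fin n))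
    (W : Matrix ({i // i ∈ A} → Fin 2) ({i // i ∈ A} → Fin 2) ℂ) (ψ φ : QState n)
    (i : {i // i ∈ A} → Fin 2) :
    relativeState A W (ψ - φ) i = relativeState A W ψ i - relativeState A W φ i := by
  ext z
  simp [relativeState, mul_sub, Finset.sum_sub_distrib]

/-- For unitary `W` and a unit vector `ψ`, this is the probability of outcome `i` when `A` is
measured in the basis `W`; `relativeState` is the unnormalized state left on the complement. -/
theorem star_mul_reducedDensity_mul_diag {n : ℕ} (A : Finset (Fin n))
    (W : Matrix ({i // i ∈ A} → Fin 2) ({i // i ∈ A} → Fin 2) ℂ) (ψ : QState n)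
    (i : {i // i ∈ A} → Fin 2) :
    (star W * reducedDensity A ψ * W) i i = ((‖relativeState A W ψ i‖ ^ 2 : ℝ) : ℂ) := by
  rw [EuclideanSpace.norm_sq_eq, Complex.ofReal_sum, Matrix.mul_apply]
  simp only [Matrix.mul_apply, Matrix.star_apply, reducedDensity, partialTrace, Matrix.of_apply,
    Matrix.vecMulVec_apply, Pi.star_apply, relativeState, Complex.ofReal_pow, ← Complex.mul_conj',
    map_sum, map_mul, Finset.sum_mul, Finset.mul_sum, Complex.star_def, Complex.conj_conj]
  rw [Finset.sum_comm]
  rw [Finset.sum_congr rfl fun _ _ => Finset.sum_comm]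
  rw [Finset.sum_comm]
  rw [Finset.sum_congr rfl fun _ _ => Finset.sum_comm]
  refine Finset.sum_congr rfl fun z _ => Finset.sum_congr rfl fun y _ =>
    Finset.sum_congr rfl fun x _ => ?_
  ring

theorem trace_reducedDensity {n : ℕ} (A : Finset (Fin n)) (ψ : QState n) :
    (reducedDensity A ψ).trace = ((‖(WithLp.toLp 2 ψ : EuclideanSpace ℂ (BitString n))‖ ^ 2 : ℝ) :
      ℂ) := by
  rw [EuclideanSpace.norm_sq_eq, Complex.ofReal_sum]
  simp only [Matrix.trace, Matrix.diag_apply, reducedDensity, partialTrace, Matrix.of_apply,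
    Matrix.vecMulVec_apply, Pi.star_apply, Complex.star_def, Complex.mul_conj', Complex.ofReal_pow]
  rw [← Fintype.sum_prod_type' (f := fun x z => ((‖ψ (joinBits A x z)‖ : ℂ)) ^ 2)]
  exact Fintype.sum_equiv (Equiv.piEquivPiSubtypeProd (fun i => i ∈ A) fun _ => Fin 2).symm _ _
    fun _ => rfl

/-- The squared norms over all `i` add up to the trace, `‖ψ‖ ^ 2`. Applied to a difference of
states, this is the Lipschitz estimate. -/
theorem norm_relativeState_le {n : ℕ} (A : Finset (Fin n))
    (W : Matrix.unitaryGroup ({i // i ∈ A} → Fin 2) ℂ) (ψ : QState n)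
    (i : {i // i ∈ A} → Fin 2) :
    ‖relativeState A W ψ i‖ ≤ ‖(WithLp.toLp 2 ψ : EuclideanSpace ℂ (BitString n))‖ := by
  refine le_of_sq_le_sq ?_ (norm_nonneg _)
  have h1 : (star (W : Matrix _ _ ℂ) * reducedDensity A ψ * (W : Matrix _ _ ℂ)).trace =
      (reducedDensity A ψ).trace := by
    rw [Matrix.trace_mul_comm, ← mul_assoc, Matrix.mem_unitaryGroup_iff.1 W.2, one_mul]
  rw [trace_reducedDensity] at h1
  simp only [Matrix.trace, Matrix.diag_apply, star_mul_reducedDensity_mul_diag] at h1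
  rw [← Complex.ofReal_sum, Complex.ofReal_inj] at h1
  rw [← h1]
  exact Finset.single_le_sum (f := fun i => ‖relativeState A W ψ i‖ ^ 2)
    (fun j _ => sq_nonneg _) (Finset.mem_univ i)

open ComplexOrder in
theorem reducedDensity_posSemidef {n : ℕ} (A : Finset (Fin n)) (ψ : QState n) :
    (reducedDensity A ψ).PosSemidef := by
  have h : reducedDensity A ψ = (Matrix.of fun x z => ψ (joinBits A x z)) *
      (Matrix.of fun x z => ψ (joinBits A x z))ᴴ := by
    ext x y
    simp [reducedDensity, partialTrace, Matrix.mul_apply, Matrix.vecMulVec_apply]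
  rw [h]
  exact Matrix.posSemidef_self_mul_conjTranspose _

theorem entanglementEntropy_eq {n : ℕ} (A : Finset (Fin n)) (ψ : QState n) :
    entanglementEntropy A ψ = (∑ i, Real.negMulLog
      ((reducedDensity_isHermitian A ψ).eigenvalues i)) / Real.log 2 := by
  simp only [entanglementEntropy, Real.negMulLog, Real.logb, Finset.sum_div,
    ← Finset.sum_neg_distrib]
  refine Finset.sum_congr rfl fun i _ => ?_
  ring

/-- Both states are dephased in the eigenbasis `W` of `ψ`: this is exact for `ψ` and can only raise
the entropy of `φ`, so eigenvalues of different matrices are never matched. The factor `2 ^ n`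
bounds the number of terms. -/
theorem entanglementEntropy_sub_le {n : ℕ} (A : Finset (Fin n)) {ψ φ : QState n}
    (hψ : ‖(WithLp.toLp 2 ψ : EuclideanSpace ℂ (BitString n))‖ = 1)
    (hφ : ‖(WithLp.toLp 2 φ : EuclideanSpace ℂ (BitString n))‖ = 1) :
    entanglementEntropy A φ - entanglementEntropy A ψ ≤ 6 * 2 ^ n / Real.log 2 *
      ‖(WithLp.toLp 2 (φ - ψ) : EuclideanSpace ℂ (BitString n))‖ := by
  have hlog2 : 0 < Real.log 2 := Real.log_pos (by norm_num)
  set W := (reducedDensity_isHermitian A ψ).eigenvectorUnitary with hW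
  have h1 := (reducedDensity_posSemidef A φ).sum_negMulLog_eigenvalues_le W
  have h2 : ∀ i, (reducedDensity_isHermitian A ψ).eigenvalues i =
      ‖relativeState A W ψ i‖ ^ 2 := by
    intro i
    have h3 := congrFun (congrFun
      (reducedDensity_isHermitian A ψ).star_eigenvectorUnitary_mul_mul i) i
    rw [star_mul_reducedDensity_mul_diag, Matrix.diagonal_apply_eq, Complex.ofReal_inj] at h3
    exact h3.symm
  simp only [star_mul_reducedDensity_mul_diag, Complex.ofReal_re] at h1
  rw [entanglementEntropy_eq, entanglementEntropy_eq, ← sub_div, div_mul_eq_mul_div]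
  refine div_le_div_of_nonneg_right ?_ hlog2.le
  simp only [h2]
  refine (sub_le_sub_right h1 _).trans ?_
  rw [← Finset.sum_sub_distrib]
  have h4 : ∀ i, Real.negMulLog (‖relativeState A W φ i‖ ^ 2) -
      Real.negMulLog (‖relativeState A W ψ i‖ ^ 2) ≤
      6 * ‖(WithLp.toLp 2 (φ - ψ) : EuclideanSpace ℂ (BitString n))‖ := by
    intro i
    refine (le_abs_self _).trans ((abs_negMulLog_sq_sub_le (norm_nonneg _)
      (hφ ▸ norm_relativeState_le A W φ i) (norm_nonneg _)
      (hψ ▸ norm_relativeState_le A W ψ i)).trans ?_)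
    refine mul_le_mul_of_nonneg_left ((abs_norm_sub_norm_le _ _).trans ?_) (by norm_num)
    rw [← relativeState_sub]
    exact norm_relativeState_le A W _ i
  refine (Finset.sum_le_sum fun i _ => h4 i).trans ?_
  rw [Finset.sum_const, nsmul_eq_mul, ← mul_assoc]
  refine mul_le_mul_of_nonneg_right ?_ (norm_nonneg _)
  rw [mul_comm]
  refine mul_le_mul_of_nonneg_left ?_ (by norm_num)
  rw [Finset.card_univ, Fintype.card_fun, Fintype.card_coe, Fintype.card_fin]
  push_cast
  exact pow_le_pow_right₀ (by norm_num) (by simpa using A.card_le_univ)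

theorem abs_entanglementEntropy_sub_le {n : ℕ} (A : Finset (Fin n)) {ψ φ : QState n}
    (hψ : ‖(WithLp.toLp 2 ψ : EuclideanSpace ℂ (BitString n))‖ = 1)
    (hφ : ‖(WithLp.toLp 2 φ : EuclideanSpace ℂ (BitString n))‖ = 1) :
    |entanglementEntropy A φ - entanglementEntropy A ψ| ≤ 6 * 2 ^ n / Real.log 2 *
      ‖(WithLp.toLp 2 (φ - ψ) : EuclideanSpace ℂ (BitString n))‖ := by
  rw [abs_le]
  refine ⟨?_, entanglementEntropy_sub_le A hψ hφ⟩
  have h := entanglementEntropy_sub_le A hφ hψ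
  rw [WithLp.toLp_sub, norm_sub_rev, ← WithLp.toLp_sub] at h
  linarith

theorem entanglementEntropy_smul {n : ℕ} (A : Finset (Fin n)) (ψ : QState n) {z : ℂ}
    (hz : ‖z‖ = 1) : entanglementEntropy A (z • ψ) = entanglementEntropy A ψ := by
  have h : reducedDensity A (z • ψ) = reducedDensity A ψ := by
    ext x y
    simp only [reducedDensity, partialTrace, Matrix.of_apply, Matrix.vecMulVec_apply, Pi.smul_apply,
      Pi.star_apply, smul_eq_mul, star_mul']
    refine Finset.sum_congr rfl fun w _ => ?_
    rw [mul_mul_mul_comm, Complex.star_def, Complex.mul_conj', hz]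
    simp
  simp only [entanglementEntropy, h]

/-! ### State preparation and conclusion. -/

theorem norm_toLp_unitary_mulVec_zeroState {n : ℕ} (U : QUnitary n) :
    ‖(WithLp.toLp 2 ((U : QOperator n).mulVec (zeroState n)) : EuclideanSpace ℂ (BitString n))‖ =
      1 := by
  rw [← sq_eq_sq₀ (norm_nonneg _) zero_le_one, one_pow, EuclideanSpace.norm_sq_eq]
  simp only [zeroState, Matrix.mulVec_single_one, Matrix.col_apply]
  exact Matrix.unitaryGroup.sum_norm_sq_col U _

theorem exists_unitary_mulVec_zeroState {n : ℕ} {ψ : QState n} (hψ : star ψ ⬝ᵥ ψ = 1) :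
    ∃ U : QUnitary n, (U : QOperator n).mulVec (zeroState n) = ψ := by
  have hn : ‖(WithLp.toLp 2 ψ : EuclideanSpace ℂ (BitString n))‖ = 1 := by
    rw [← sq_eq_sq₀ (norm_nonneg _) zero_le_one, one_pow, EuclideanSpace.norm_sq_eq]
    simp only [dotProduct, Pi.star_apply, Complex.star_def, Complex.conj_mul'] at hψ
    exact_mod_cast hψ
  obtain ⟨b, hb⟩ := Orthonormal.exists_orthonormalBasis_extension_of_card_eq (𝕜 := ℂ)
    (E := EuclideanSpace ℂ (BitString n)) (ι := BitString n) finrank_euclideanSpace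
    (v := fun _ => WithLp.toLp 2 ψ) (s := {fun _ => 0}) (by
      refine ⟨fun _ => hn, fun i j hij => (hij (Subsingleton.elim i j)).elim⟩)
  refine ⟨⟨_, (EuclideanSpace.basisFun (BitString n) ℂ).toMatrix_orthonormalBasis_mem_unitary b⟩,
    ?_⟩
  ext x
  simp [zeroState, Module.Basis.toMatrix_apply, hb]

theorem lemma2 :
    ∃ c : ℝ, 0 ≤ c ∧ c ≤ 4 ∧
      ∀ (n : ℕ) (G : Set (QUnitary n)), IsUniversal G → (∀ g ∈ G, g⁻¹ ∈ G) →
        ∃ C : ℝ, 0 < C ∧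
          ∀ (H : QOperator n), H.IsHermitian → ∀ ψ₀ : QState n, IsGroundState H ψ₀ →
            (∃ U : QUnitary n, (U : QOperator n).mulVec (zeroState n) = ψ₀) ∧
            ∀ U : QUnitary n, (U : QOperator n).mulVec (zeroState n) = ψ₀ →
              ∀ ε : ℝ, 0 < ε → ε ≤ 1 / 2 →
                ∃ L : List (QUnitary n), IsCircuit G L ∧
                  (L.length : ℝ) ≤ C * Real.log (1 / ε) ^ c ∧
                  ApproxUpToPhase L.prod U ε ∧
                  ∀ A : Finset (Fin n),
                    |entanglementEntropy A ((L.prod : QOperator n).mulVec (zeroState n)) -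
                      entanglementEntropy A ψ₀| ≤ C * ε := by
  refine ⟨4, by norm_num, le_rfl, fun n G hG hinv => ?_⟩
  obtain ⟨C, hC, hSK⟩ := hG.exists_length_le hinv
  have hlog2 : 0 < Real.log 2 := Real.log_pos (by norm_num)
  have hC' : 0 < 6 * 2 ^ n / Real.log 2 := by positivity
  refine ⟨C + 6 * 2 ^ n / Real.log 2, by positivity, fun H _ ψ₀ hψ₀ =>
    ⟨exists_unitary_mulVec_zeroState hψ₀.1, ?_⟩⟩
  rintro U rfl ε hε hε2
  obtain ⟨L, hL, hlen, z, hz, hn⟩ := hSK U ε hε hε2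
  refine ⟨L, hL, ?_, ⟨z, hz, hn⟩, fun A => ?_⟩
  · have h4 : Real.log (1 / ε) ^ (4 : ℝ) = Real.log (1 / ε) ^ 4 := by
      exact_mod_cast Real.rpow_natCast _ 4
    rw [h4]
    refine hlen.trans (mul_le_mul_of_nonneg_right (by linarith) (by positivity))
  -- The phase `z` is moved into the target state, where it leaves the entropy unchanged; the
  -- operator norm bound then applies to the unit vector `zeroState n`.
  · rw [← entanglementEntropy_smul A ((U : QOperator n).mulVec (zeroState n)) hz]
    refine (abs_entanglementEntropy_sub_le A ?_ (norm_toLp_unitary_mulVec_zeroState _)).trans ?_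
    · rw [WithLp.toLp_smul, norm_smul, hz, norm_toLp_unitary_mulVec_zeroState, one_mul]
    · refine mul_le_mul (by linarith) ?_ (norm_nonneg _) (by positivity)
      rw [← Matrix.smul_mulVec, ← Matrix.sub_mulVec]
      have h := ((L.prod : QOperator n) - z • (U : QOperator n)).l2_opNorm_mulVec
        (EuclideanSpace.single (fun _ => 0) 1)
      rw [PiLp.norm_single, norm_one, mul_one] at h
      exact h.trans hn
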